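/- Let $d,n$ be positive integers and consider $n$ qudits $A_1,\dots,A_n$, each with orthonormal basis $|0\rangle,\dots,|d-1\rangle$. A GWV state is a state $$|\psi\rangle=\sqrt p\,\sum_{i=1}^{d-1}\bigl(a_{1i}|i0\cdots0\rangle+a_{2i}|0i0\cdots0\rangle+\cdots+a_{ni}|0\cdots0i\rangle\bigr)+\sqrt{1-p}\,|0\cdots0\rangle,$$ where $0\le p\le1$, $a_{si}\in\mathbb C$ and $\sum_{s=1}^n\sum_{i=1}^{d-1}|a_{si}|^2=1$. For $q>0$, the Tsallis-$q$ entanglement of a bipartite pure state $|\varphi\rangle_{AB}$ with reduced density matrix $\rho_A$ is $T_q(|\varphi\rangle_{AB})=\frac{1-\operatorname{tr}\rho_A^q}{q-1}$ if $q\ne1$, and its limit $-\operatorname{tr}\rho_A\ln\rho_A$ if $q=1$. For a bipartite mixed state, $T_q(\rho_{AB})=\min\sum_i p_i\,T_q(|\varphi_i\rangle)$, where the minimum is over all decompositions $\rho_{AB}=\sum_i p_i|\varphi_i\rangle\langle\varphi_i|$ into pure states. Let $|\psi\rangle$ be a GWV state, let $r\ge3$, and let $P,P_0,\dots,P_{r-1}$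 be pairwise disjoint non-empty sets of the qudits (a partition of some subset $\{A_{i_1},\dots,A_{i_m}\}$ of $\{A_1,\dots,A_n\}$). Write $T_q(\rho_{P|P_i\cdots P_{r-1}})$ for the Tsallis-$q$ entanglement, across the cut between $P$ and $P_i\cup\cdots\cup P_{r-1}$, of the reduced density matrix of $|\psi\rangle$ on $P\cup P_i\cup\cdots\cup P_{r-1}$, and $T_q(\rho_{PP_j})$ for that of the reduced density matrix on $P\cup P_j$ across the cut between $P$ and $P_j$. Let $q\in\left[\frac{5-\sqrt{13}}2,\frac{5+\sqrt{13}}2\right]$, $\beta\ge2$, $0<k\le1$, let $t$ be an integer with $0\le t\le r-3$, and put $\mathcal K_\beta=\frac{(1+k)^{\beta/2}-1}{k^{\beta/2}}$. If $$k\,T_q^2(\rho_{PP_i})\ge T_q^2(\rho_{P|P_{i+1}\cdots P_{r-1}})\quad\text{for } i=0,1,\dots,t$$ and $$T_q^2(\rho_{PP_j})\le k\,T_q^2(\rho_{P|P_{j+1}\cdots P_{r-1}})\quad\text{for } j=t+1,\dots,r-2,$$ then $$T_q^\beta(\rho_{P|P_0\cdots P_{r-1}})\ \ge\ \sum_{j=0}^{t}\mathcal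 K_\beta^{\,j}\,T_q^\beta(\rho_{PP_j})+\mathcal K_\beta^{\,t+2}\sum_{j=t+1}^{r-2}T_q^\beta(\rho_{PP_j})+\mathcal K_\beta^{\,t+1}\,T_q^\beta(\rho_{PP_{r-1}}).$$ -/

import Mathlib

open Finset

namespace TsallisGWV

noncomputable section

/-- The computational basis vector `|x⟩` of a system with index set `ι` of basis states. -/
def ket {ι : Type*} [DecidableEq ι] (x : ι) : ι → ℂ := Pi.single x 1

/-- The rank-one matrix `|φ⟩⟨φ|`. -/
def proj {ι : Type*} (φ : ι → ℂ) : Matrix ι ι ℂ := Matrix.vecMulVec φ (star φ)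

/-- The `n`-qudit generalized `W`-class vector `∑ₛ ∑_{i = 1}^{d-1} aₛᵢ |0⋯0 i 0⋯0⟩`,
with `i` at position `s`. -/
def wVector {n d : ℕ} [NeZero d] (a : Fin n → Fin d → ℂ) : (Fin n → Fin d) → ℂ :=
  ∑ s : Fin n, ∑ i ∈ univ.filter (fun i : Fin d => i ≠ 0),
    a s i • ket (Function.update (fun _ : Fin n => (0 : Fin d)) s i)

/-- `ψ` is a GWV state: a superposition `√p |W⟩ + √(1-p) |0⋯0⟩` of a (normalized) `n`-qudit
generalized `W`-class state and the vacuum, `0 ≤ p ≤ 1`. -/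
def IsGWV {n d : ℕ} [NeZero d] (ψ : (Fin n → Fin d) → ℂ) : Prop :=
  ∃ (a : Fin n → Fin d → ℂ) (p : ℝ), 0 ≤ p ∧ p ≤ 1 ∧
    ∑ s : Fin n, ∑ i ∈ univ.filter (fun i : Fin d => i ≠ 0), ‖a s i‖ ^ 2 = 1 ∧
    ψ = ((Real.sqrt p : ℝ) : ℂ) • wVector a
      + ((Real.sqrt (1 - p) : ℝ) : ℂ) • ket (fun _ : Fin n => (0 : Fin d))

/-- The basis state of the `n` qudits that is `x` on `P`, `y` on `R` and `z` elsewhere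
(for disjoint `P` and `R`). -/
def glue {n d : ℕ} (P R : Finset (Fin n)) (x : P → Fin d) (y : R → Fin d)
    (z : {i : Fin n // i ∉ P ∪ R} → Fin d) : Fin n → Fin d := fun i =>
  if hP : i ∈ P then x ⟨i, hP⟩
  else if hR : i ∈ R then y ⟨i, hR⟩
  else z ⟨i, by simp [hP, hR]⟩

/-- The reduced density matrix of an `n`-qudit state `ρ` on the subsystems `P ∪ R`
(partial trace over all the other qudits), as a bipartite matrix with respect to the cut `P | R`.
Meant for disjoint `P` and `R`. -/
def reduced {n d : ℕ} (ρ : Matrix (Fin n → Fin d) (Fin n → Fin d) ℂ) (P R : Finset (Fin n)) :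
    Matrix ((P → Fin d) × (R → Fin d)) ((P → Fin d) × (R → Fin d)) ℂ :=
  Matrix.of fun u v => ∑ z : {i : Fin n // i ∉ P ∪ R} → Fin d,
    ρ (glue P R u.1 u.2 z) (glue P R v.1 v.2 z)

/-- The Tsallis-`q` entropy `(1 - tr A ^ q) / (q - 1)` of a density matrix `A`, through the
eigenvalues of `A`; at `q = 1` it is its limit, the von Neumann entropy `-tr (A log A)`. -/
def tsallisEntropy {α : Type*} [Fintype α] [DecidableEq α] (q : ℝ) (A : Matrix α α ℂ)
    (hA : A.IsHermitian) : ℝ :=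
  if q = 1 then ∑ i, Real.negMulLog (hA.eigenvalues i)
  else (1 - ∑ i, hA.eigenvalues i ^ q) / (q - 1)

/-- The coefficient matrix of a bipartite vector. -/
def coeffMatrix {α β : Type*} (φ : α × β → ℂ) : Matrix α β ℂ := Matrix.of fun a b => φ (a, b)

/-- The reduced density matrix `ρ_A` of a bipartite pure state `φ` of `AB`: its entry at `(a, a')`
is `∑_b φ (a, b) * conj (φ (a', b))`. -/
def margA {α β : Type*} [Fintype β] (φ : α × β → ℂ) : Matrix α α ℂ :=
  coeffMatrix φ * (coeffMatrix φ).conjTranspose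

theorem margA_isHermitian {α β : Type*} [Fintype β] (φ : α × β → ℂ) : (margA φ).IsHermitian :=
  Matrix.isHermitian_mul_conjTranspose_self _

/-- The Tsallis-`q` entanglement of a bipartite pure state. -/
def pureT {α β : Type*} [Fintype α] [DecidableEq α] [Fintype β] (q : ℝ) (φ : α × β → ℂ) : ℝ :=
  tsallisEntropy q (margA φ) (margA_isHermitian φ)

/-- `(w, φ)` is a pure state decomposition of `ρ`: `ρ = ∑ᵢ wᵢ |φᵢ⟩⟨φᵢ|` with a finite probability
vector `w` and unit vectors `φᵢ`. -/
def IsPureDecomposition {ι : Type*} [Fintype ι] {N : ℕ} (ρ : Matrix ι ι ℂ)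
    (w : Fin N → ℝ) (φ : Fin N → ι → ℂ) : Prop :=
  (∀ i, 0 ≤ w i) ∧ ∑ i, w i = 1 ∧ (∀ i, ∑ x, ‖φ i x‖ ^ 2 = 1) ∧
    ρ = ∑ i, ((w i : ℝ) : ℂ) • proj (φ i)

/-- The Tsallis-`q` entanglement of a bipartite mixed state: the convex roof
`min ∑ᵢ wᵢ T_q(φᵢ)` over all pure state decompositions. -/
def mixedT {α β : Type*} [Fintype α] [DecidableEq α] [Fintype β] (q : ℝ)
    (ρ : Matrix (α × β) (α × β) ℂ) : ℝ :=
  sInf {s : ℝ | ∃ (N : ℕ) (w : Fin N → ℝ) (φ : Fin N → α × β → ℂ),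
    IsPureDecomposition ρ w φ ∧ s = ∑ i, w i * pureT q (φ i)}

/-- `T_q(ρ_{P|R})` for the reduced density matrix on `P ∪ R` of an `n`-qudit pure state `ψ`. -/
def T {n d : ℕ} (q : ℝ) (ψ : (Fin n → Fin d) → ℂ) (P R : Finset (Fin n)) : ℝ :=
  mixedT q (reduced (proj ψ) P R)

/-- The constant `((1 + k) ^ (β / 2) - 1) / k ^ (β / 2)`. -/
def K (k β : ℝ) : ℝ := ((1 + k) ^ (β / 2) - 1) / k ^ (β / 2)

end

end TsallisGWV

namespace TsallisGWV

/-! Every Tsallis entanglement in the statement is an explicit function of a concurrence. Write `m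
s` for the squared norm of the part of the GWV state excited at qudit `s`. Tracing out all qudits
outside `P ∪ R` leaves a mixture of `|u⟩|0⟩ + |0⟩|v⟩ + c|00⟩` with `|00⟩`, hence a state of rank at
most two. Every pure state in a decomposition of it lies in the span of `η = |u⟩|0⟩ + |0⟩|v⟩` and
`|00⟩`; its concurrence depends only on its `η` coefficient, and the average concurrence is the same
for all decompositions, namely `C = 2 √(m(P) m(R))`. Once `concT q` is convex in the concurrence,
the convex roof equals `concT q C` (`mixedT_eq_concT`, `exists_T_eq_concT`).

Convexity (`concT_convexOn`) is where the range of `q` enters. With `C = 1 / cosh θ` and `m = q -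
1`, monotonicity of the derivative becomes positivity of a combination of hyperbolic sines, which
holds coefficient by coefficient in its power series when `m ^ 2 - 3 * m - 1 ≤ 0`, that is, for `q`
between `(5 ± √13) / 2`.

Since `C ^ 2` is additive in `R`, and `concT q` is convex and vanishes at 0, the square of `T` is
superadditive in `R` (`T_sq_add_sq_le`). Splitting off one `P_j` at a time with the scalar
inequality `rpow_add_K_mul_rpow_le` then yields the weighted bound. -/

/-! ### A hyperbolic sine inequality. -/

/-- Bernoulli's inequality puts `X ^ j` above its tangent line at `D`; averaging over `A` and `B`
reduces all exponents to the cases `j = 0` and `j = 1`. -/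
theorem mul_pow_le_add_mul_pow {a b c A B D : ℝ} (ha : 0 ≤ a) (hb : 0 ≤ b) (hA : 0 ≤ A)
    (hB : 0 ≤ B) (hD : 0 < D) (h0 : a + b = c) (h1 : c * D ≤ a * A + b * B) (j : ℕ) :
    c * D ^ j ≤ a * A ^ j + b * B ^ j := by
  have key : ∀ X : ℝ, 0 ≤ X → (1 + j * (X / D - 1)) * D ^ j ≤ X ^ j := by
    intro X hX
    have hXD : 0 ≤ X / D := by positivity
    have h := one_add_mul_le_pow (a := X / D - 1) (by linarith) j
    have h2 := mul_le_mul_of_nonneg_right h (pow_nonneg hD.le j)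
    rwa [← mul_pow, add_sub_cancel, div_mul_cancel₀ _ hD.ne'] at h2
  have hA' := mul_le_mul_of_nonneg_left (key A hA) ha
  have hB' := mul_le_mul_of_nonneg_left (key B hB) hb
  have h3 : 0 ≤ (a * A + b * B - c * D) / D := div_nonneg (by linarith) hD.le
  have h4 : (a * A + b * B - c * D) / D = a * (A / D - 1) + b * (B / D - 1) := by
    subst h0; field_simp; ring
  have h5 : 0 ≤ (j * (a * (A / D - 1) + b * (B / D - 1))) * D ^ j := by
    rw [← h4]; positivity
  subst h0
  nlinarith

/-- For `j = 0` the expression vanishes identically, and for `j = 1` it is `-8 * m ^ 2 * (m ^ 2 - 3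
* m - 1)`. These are the two inputs of `mul_pow_le_add_mul_pow`, which propagates them to all `j`.
-/
theorem sinh_comb_coeff_nonneg {m : ℝ} (hm : m ^ 2 - 3 * m - 1 ≤ 0) (j : ℕ) :
    0 ≤ m * ((m + 2) ^ (2 * j + 1) + (1 + 2 * m) * (m - 2) ^ (2 * j + 1)
      + 2 * (1 - m) * m ^ (2 * j + 1)) := by
  simp only [pow_succ, pow_mul, pow_zero, one_mul]
  simp only [← sq]
  -- The signs of `m`, `m - 1` and `m - 2` decide which of the three terms has to be dominated by
  -- the other two.
  rcases lt_trichotomy m 0 with h | rfl | h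
  · have hl : -1 / 2 < m := by nlinarith
    have := mul_pow_le_add_mul_pow (a := (1 + 2 * m) * (2 - m)) (b := 2 * (1 - m) * (-m))
      (c := m + 2) (A := (m - 2) ^ 2) (B := m ^ 2) (D := (m + 2) ^ 2)
      (mul_nonneg (by linarith) (by linarith)) (mul_nonneg (by linarith) (by linarith))
      (sq_nonneg _) (sq_nonneg _) (pow_pos (by linarith) 2) (by ring)
      (by nlinarith [mul_nonneg (neg_nonneg.2 h.le) (neg_nonneg.2 hm)]) j
    refine mul_nonneg_of_nonpos_of_nonpos h.le ?_
    linarith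
  · simp
  refine mul_nonneg h.le ?_
  rcases le_total m 1 with h1 | h1
  · have := mul_pow_le_add_mul_pow (a := m + 2) (b := 2 * (1 - m) * m)
      (c := (1 + 2 * m) * (2 - m)) (A := (m + 2) ^ 2) (B := m ^ 2) (D := (m - 2) ^ 2)
      (by linarith) (mul_nonneg (by linarith) (by linarith))
      (sq_nonneg _) (sq_nonneg _) (by nlinarith) (by ring)
      (by nlinarith [mul_nonneg h.le (neg_nonneg.2 hm)]) j
    linarith
  -- For `1 ≤ m ≤ 2` two terms are nonpositive; `m + 2` is the largest base, so comparing powers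
  -- directly and using the `j = 0` identity suffices.
  rcases le_total m 2 with h2 | h2
  · have e1 : ((m - 2) ^ 2) ^ j ≤ ((m + 2) ^ 2) ^ j := by
      gcongr 1; nlinarith
    have e2 : (m ^ 2) ^ j ≤ ((m + 2) ^ 2) ^ j := by
      gcongr 1; nlinarith
    have e3 := mul_le_mul_of_nonneg_left e1
      (mul_nonneg (by linarith : 0 ≤ 1 + 2 * m) (by linarith : 0 ≤ 2 - m))
    have e4 := mul_le_mul_of_nonneg_left e2
      (mul_nonneg (by linarith : 0 ≤ 2 * (m - 1)) h.le)
    linarith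
  · have := mul_pow_le_add_mul_pow (a := m + 2) (b := (1 + 2 * m) * (m - 2))
      (c := 2 * (m - 1) * m) (A := (m + 2) ^ 2) (B := (m - 2) ^ 2) (D := m ^ 2)
      (by linarith) (mul_nonneg (by linarith) (by linarith))
      (sq_nonneg _) (sq_nonneg _) (by positivity) (by ring)
      (by nlinarith [mul_nonneg h.le (neg_nonneg.2 hm)]) j
    linarith

theorem sinh_comb_nonneg {m θ : ℝ} (hm : m ^ 2 - 3 * m - 1 ≤ 0) (hθ : 0 ≤ θ) :
    0 ≤ m * (Real.sinh ((m + 2) * θ) + (1 + 2 * m) * Real.sinh ((m - 2) * θ)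
      + 2 * (1 - m) * Real.sinh (m * θ)) := by
  have h := (((Real.hasSum_sinh ((m + 2) * θ)).add
    ((Real.hasSum_sinh ((m - 2) * θ)).mul_left (1 + 2 * m))).add
    ((Real.hasSum_sinh (m * θ)).mul_left (2 * (1 - m)))).mul_left m
  refine h.nonneg fun j => ?_
  have e := mul_nonneg (sinh_comb_coeff_nonneg hm j)
    (by positivity : 0 ≤ θ ^ (2 * j + 1) / ((2 * j + 1).factorial : ℝ))
  refine e.trans_eq ?_
  simp only [mul_pow]
  ring

/-- `sinh (m θ) / m`, extended by its limit `θ` to `m = 0`. -/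
noncomputable def sinhDiv (m θ : ℝ) : ℝ := if m = 0 then θ else Real.sinh (m * θ) / m

theorem hasDerivAt_sinhDiv (m θ : ℝ) : HasDerivAt (sinhDiv m) (Real.cosh (m * θ)) θ := by
  unfold sinhDiv
  split_ifs with h
  · rw [h, zero_mul, Real.cosh_zero]
    exact hasDerivAt_id θ
  · have := (((hasDerivAt_id θ).const_mul m).sinh).div_const m
    refine this.congr_deriv ?_
    simp only [id]
    field_simp

/-- This is the sign condition for the derivative of `slope m`. -/
theorem cosh_mul_le_sinhDiv_mul {m θ : ℝ} (hm : m ^ 2 - 3 * m - 1 ≤ 0) (hθ : 0 ≤ θ) :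
    Real.cosh (m * θ) * (Real.sinh θ * Real.cosh θ)
      ≤ sinhDiv m θ * (Real.cosh θ ^ 2 + m * Real.sinh θ ^ 2) := by
  unfold sinhDiv
  split_ifs with h
  · subst h
    -- At `m = 0` the claim reduces to `sinh θ ≤ θ * cosh θ`; the series bound, which carries a
    -- factor `m`, says nothing here.
    have hmono : MonotoneOn (fun x => x * Real.cosh x - Real.sinh x) (Set.Ici 0) := by
      refine monotoneOn_of_deriv_nonneg (convex_Ici 0) (by fun_prop) (by fun_prop) ?_
      intro x hx
      rw [interior_Ici] at hx
      have : HasDerivAt (fun x => x * Real.cosh x - Real.sinh x)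
          (1 * Real.cosh x + x * Real.sinh x - Real.cosh x) x :=
        ((hasDerivAt_id x).mul (Real.hasDerivAt_cosh x)).sub (Real.hasDerivAt_sinh x)
      rw [this.deriv]
      have := mul_nonneg hx.out.le (Real.sinh_nonneg_iff.2 hx.out.le)
      linarith
    have := hmono Set.self_mem_Ici hθ hθ
    simp only [Real.sinh_zero, zero_mul, sub_zero, Real.cosh_zero, one_mul, add_zero] at this ⊢
    nlinarith [Real.cosh_pos θ]
  -- By the addition formulas the sinh combination is `4 * m ^ 2` times the gap to be shown
  -- nonnegative.
  · have e := sinh_comb_nonneg hm hθ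
    have h2 : 0 < m ^ 2 := by positivity
    rw [show (m + 2) * θ = m * θ + 2 * θ by ring, show (m - 2) * θ = m * θ - 2 * θ by ring,
      Real.sinh_add, Real.sinh_sub, Real.cosh_two_mul, Real.sinh_two_mul] at e
    have hc := Real.cosh_sq θ
    have e3 : Real.sinh (m * θ) / m * (Real.cosh θ ^ 2 + m * Real.sinh θ ^ 2)
        - Real.cosh (m * θ) * (Real.sinh θ * Real.cosh θ)
        = (m * Real.sinh (m * θ) * (Real.cosh θ ^ 2 + m * Real.sinh θ ^ 2)
        - m ^ 2 * Real.cosh (m * θ) * (Real.sinh θ * Real.cosh θ)) / m ^ 2 := by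
      field_simp
    rw [← sub_nonneg, e3]
    refine div_nonneg ?_ h2.le
    rw [hc] at e ⊢
    linarith

/-- The derivative of the Tsallis entanglement with respect to the concurrence `1 / cosh θ`,
up to the factor `m + 1`. -/
noncomputable def slope (m θ : ℝ) : ℝ :=
  sinhDiv m θ / (Real.sinh θ * (2 * Real.cosh θ) ^ m)

theorem slope_antitoneOn {m : ℝ} (hm : m ^ 2 - 3 * m - 1 ≤ 0) :
    AntitoneOn (slope m) (Set.Ioi 0) := by
  have hd : ∀ θ ∈ Set.Ioi (0 : ℝ), HasDerivAt (slope m)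
      ((Real.cosh (m * θ) * (Real.sinh θ * (2 * Real.cosh θ) ^ m) - sinhDiv m θ *
        (Real.cosh θ * (2 * Real.cosh θ) ^ m + Real.sinh θ *
          (2 * Real.sinh θ * m * (2 * Real.cosh θ) ^ (m - 1)))) /
        (Real.sinh θ * (2 * Real.cosh θ) ^ m) ^ 2) θ := by
    intro θ hθ
    have hs : 0 < Real.sinh θ := Real.sinh_pos_iff.2 hθ
    have hc : 0 < 2 * Real.cosh θ := by have := Real.cosh_pos θ; positivity
    refine (hasDerivAt_sinhDiv m θ).div ((Real.hasDerivAt_sinh θ).mul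
      (((Real.hasDerivAt_cosh θ).const_mul 2).rpow_const (Or.inl hc.ne'))) ?_
    have := Real.rpow_pos_of_pos hc m
    positivity
  refine antitoneOn_of_deriv_nonpos (convex_Ioi 0)
    (fun θ hθ => (hd θ hθ).continuousAt.continuousWithinAt) ?_ ?_
  · rw [interior_Ioi]
    exact fun θ hθ => (hd θ hθ).differentiableAt.differentiableWithinAt
  · rw [interior_Ioi]
    intro θ hθ
    rw [(hd θ hθ).deriv]
    refine div_nonpos_of_nonpos_of_nonneg ?_ (sq_nonneg _)
    have hc0 := Real.cosh_pos θ
    have hc : 0 < 2 * Real.cosh θ := by positivity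
    rw [Real.rpow_sub_one hc.ne']
    have e := cosh_mul_le_sinhDiv_mul hm (le_of_lt hθ)
    have hp := Real.rpow_pos_of_pos hc m
    have : Real.cosh (m * θ) * (Real.sinh θ * (2 * Real.cosh θ) ^ m) - sinhDiv m θ *
        (Real.cosh θ * (2 * Real.cosh θ) ^ m + Real.sinh θ *
          (2 * Real.sinh θ * m * ((2 * Real.cosh θ) ^ m / (2 * Real.cosh θ))))
        = (Real.cosh (m * θ) * (Real.sinh θ * Real.cosh θ) -
          sinhDiv m θ * (Real.cosh θ ^ 2 + m * Real.sinh θ ^ 2))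
          * ((2 * Real.cosh θ) ^ m / Real.cosh θ) := by
      field_simp
    rw [this]
    exact mul_nonpos_of_nonpos_of_nonneg (by linarith) (by positivity)

/-! ### Convexity of the entropy as a function of concurrence. -/

/-- The Tsallis-`q` entropy of the spectrum `(x, 1 - x)`. -/
noncomputable def binTsallis (q x : ℝ) : ℝ :=
  if q = 1 then Real.negMulLog x + Real.negMulLog (1 - x)
  else (1 - (x ^ q + (1 - x) ^ q)) / (q - 1)

/-- The Tsallis-`q` entanglement of a two-qubit pure state as a function of its concurrence. -/
noncomputable def concT (q C : ℝ) : ℝ := binTsallis q ((1 + Real.sqrt (1 - C ^ 2)) / 2)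

theorem hasDerivAt_binTsallis (q : ℝ) {x : ℝ} (h0 : 0 < x) (h1 : x < 1) :
    HasDerivAt (binTsallis q) (if q = 1 then Real.log (1 - x) - Real.log x
      else - q * (x ^ (q - 1) - (1 - x) ^ (q - 1)) / (q - 1)) x := by
  have hx : HasDerivAt (fun y : ℝ => 1 - y) (-1) x := by
    simpa using (hasDerivAt_id x).const_sub 1
  unfold binTsallis
  split_ifs with h
  · have := (Real.hasDerivAt_negMulLog h0.ne').add
      ((Real.hasDerivAt_negMulLog (by linarith : (1 - x) ≠ 0)).comp x hx)
    refine this.congr_deriv ?_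
    ring
  · have := ((((hasDerivAt_id x).rpow_const (p := q) (Or.inl h0.ne')).add
      (hx.rpow_const (p := q) (Or.inl (by linarith : (1 - x) ≠ 0)))).const_sub 1).div_const (q - 1)
    refine this.congr_deriv ?_
    simp only [id]
    ring

/-- At concurrence `1 / cosh θ` the two eigenvalues are `exp (±θ) / (2 * cosh θ)`, so a difference
of their powers is a hyperbolic sine. -/
theorem hasDerivAt_concT (q : ℝ) {θ : ℝ} (hθ : 0 < θ) :
    HasDerivAt (concT q) (q * slope (q - 1) θ) (Real.cosh θ)⁻¹ := by
  have hs : 0 < Real.sinh θ := Real.sinh_pos_iff.2 hθ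
  have hc := Real.cosh_pos θ
  have hcs := Real.cosh_sq θ
  have hsq : 1 - (Real.cosh θ)⁻¹ ^ 2 = (Real.sinh θ / Real.cosh θ) ^ 2 := by
    field_simp; linarith
  have hsqrt : Real.sqrt (1 - (Real.cosh θ)⁻¹ ^ 2) = Real.sinh θ / Real.cosh θ := by
    rw [hsq, Real.sqrt_sq (by positivity)]
  have hx : (1 + Real.sinh θ / Real.cosh θ) / 2 = Real.exp θ / (2 * Real.cosh θ) := by
    rw [← Real.cosh_add_sinh]; field_simp
  have hx' : 1 - Real.exp θ / (2 * Real.cosh θ) = Real.exp (-θ) / (2 * Real.cosh θ) := by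
    rw [← Real.cosh_sub_sinh, ← Real.cosh_add_sinh]; field_simp; ring
  have hpos : 0 < Real.exp (-θ) / (2 * Real.cosh θ) := by positivity
  have hd1 : HasDerivAt (fun C : ℝ => (1 + Real.sqrt (1 - C ^ 2)) / 2)
      (-1 / (2 * Real.sinh θ)) (Real.cosh θ)⁻¹ := by
    have h1 : HasDerivAt (fun C : ℝ => 1 - C ^ 2) (-(2 * (Real.cosh θ)⁻¹)) (Real.cosh θ)⁻¹ := by
      simpa using ((hasDerivAt_id (Real.cosh θ)⁻¹).pow 2).const_sub 1
    have h2 := ((h1.sqrt (by rw [hsq]; positivity)).const_add 1).div_const 2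
    refine h2.congr_deriv ?_
    rw [hsqrt]
    field_simp
  have hd2 := hasDerivAt_binTsallis q (x := Real.exp θ / (2 * Real.cosh θ)) (by positivity)
    (by linarith)
  have e : (1 + Real.sqrt (1 - (Real.cosh θ)⁻¹ ^ 2)) / 2 = Real.exp θ / (2 * Real.cosh θ) := by
    rw [hsqrt, hx]
  rw [← e] at hd2
  refine (HasDerivAt.comp (h₂ := binTsallis q) (Real.cosh θ)⁻¹ hd2 hd1).congr_deriv ?_
  rw [e, hx']
  unfold slope sinhDiv
  have h2c : 0 < 2 * Real.cosh θ := by positivity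
  split_ifs with h1 h2 h2
  · subst h1
    rw [Real.log_div (by positivity) (by positivity), Real.log_div (by positivity) (by positivity),
      Real.log_exp, Real.log_exp]
    simp only [sub_self, Real.rpow_zero]
    field_simp
    ring
  · exact absurd (by linarith) h2
  · exact absurd (by linarith) h1
  · have hp := Real.rpow_pos_of_pos h2c (q - 1)
    rw [Real.div_rpow (by positivity) h2c.le, Real.div_rpow (by positivity) h2c.le,
      ← Real.exp_mul, ← Real.exp_mul, Real.sinh_eq ((q - 1) * θ), mul_comm (q - 1) θ, neg_mul]
    field_simp

theorem concT_convexOn {q : ℝ} (hq0 : 0 < q) (hq : (q - 1) ^ 2 - 3 * (q - 1) - 1 ≤ 0) :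
    ConvexOn ℝ (Set.Icc 0 1) (concT q) := by
  have hparam : ∀ C ∈ Set.Ioo (0 : ℝ) 1, ∃ θ, 0 < θ ∧ C = (Real.cosh θ)⁻¹ := by
    intro C hC
    refine ⟨Real.arcosh C⁻¹, Real.arcosh_pos (one_lt_inv₀ hC.1 |>.2 hC.2), ?_⟩
    rw [Real.cosh_arcosh (one_lt_inv₀ hC.1 |>.2 hC.2).le, inv_inv]
  refine MonotoneOn.convexOn_of_deriv (convex_Icc 0 1) ?_ ?_ ?_
  · unfold concT
    have hb : Continuous (binTsallis q) := by
      unfold binTsallis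
      split_ifs
      · fun_prop
      · have h1 : Continuous fun x : ℝ => x ^ q := Real.continuous_rpow_const hq0.le
        have h2 : Continuous fun x : ℝ => (1 - x) ^ q := h1.comp (by fun_prop)
        fun_prop
    exact (hb.comp (by fun_prop)).continuousOn
  · rw [interior_Icc]
    intro C hC
    obtain ⟨θ, hθ, rfl⟩ := hparam C hC
    exact (hasDerivAt_concT q hθ).differentiableAt.differentiableWithinAt
  · rw [interior_Icc]
    intro C hC C' hC' hle
    obtain ⟨θ, hθ, rfl⟩ := hparam C hC
    obtain ⟨θ', hθ', rfl⟩ := hparam C' hC'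
    rw [(hasDerivAt_concT q hθ).deriv, (hasDerivAt_concT q hθ').deriv]
    -- The concurrence decreases in `θ`, so an antitone slope in `θ` is a monotone derivative in
    -- `C`.
    refine mul_le_mul_of_nonneg_left (slope_antitoneOn hq hθ' hθ ?_) hq0.le
    have := (inv_le_inv₀ (Real.cosh_pos _) (Real.cosh_pos _)).1 hle
    rwa [Real.cosh_le_cosh, abs_of_pos hθ, abs_of_pos hθ'] at this

theorem concT_zero {q : ℝ} (hq0 : 0 < q) : concT q 0 = 0 := by
  unfold concT binTsallis
  norm_num
  intro _
  rw [Real.zero_rpow hq0.ne']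
  simp


/-! ### Rank-one projections and W-shaped bipartite vectors. -/

theorem star_dotProduct_self {ι : Type*} [Fintype ι] (u : ι → ℂ) :
    dotProduct (star u) u = ((∑ x, ‖u x‖ ^ 2 : ℝ) : ℂ) := by
  simp [dotProduct, Complex.conj_mul']

theorem star_star_dotProduct {ι : Type*} [Fintype ι] (u v : ι → ℂ) :
    star (dotProduct (star u) v) = dotProduct (star v) u := by
  rw [← Matrix.star_dotProduct_star, star_star, dotProduct_comm, dotProduct_comm]

theorem trace_proj {ι : Type*} [Fintype ι] (x : ι → ℂ) :
    (proj x).trace = dotProduct (star x) x := by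
  rw [proj, Matrix.trace_vecMulVec, dotProduct_comm]

theorem trace_proj_mul_proj {ι : Type*} [Fintype ι] (x y : ι → ℂ) :
    (proj x * proj y).trace = dotProduct (star x) y * dotProduct (star y) x := by
  rw [proj, proj, Matrix.vecMulVec_mul_vecMulVec, Matrix.trace_vecMulVec, dotProduct_smul,
    dotProduct_comm x, smul_eq_mul]

theorem star_dotProduct_proj_mulVec {ι : Type*} [Fintype ι] (x y : ι → ℂ) :
    dotProduct (star x) ((proj y).mulVec x) = ((‖dotProduct (star x) y‖ ^ 2 : ℝ) : ℂ) := by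
  rw [proj, Matrix.vecMulVec_mulVec, dotProduct_smul, ← star_star_dotProduct x y]
  push_cast
  rw [← Complex.mul_conj', op_smul_eq_mul]
  rfl

/-- The partial trace over a system in the states `b₀` and `v`: orthogonality kills the cross terms.
It serves both the marginal of a pure state and the reduction of the full state. -/
theorem sum_superposition_mul_star {β : Type*} [Fintype β] [DecidableEq β] {b₀ : β} {v : β → ℂ}
    (hv : v b₀ = 0) (x y x' y' : ℂ) :
    ∑ b, (x * ket b₀ b + y * v b) * star (x' * ket b₀ b + y' * v b)
      = x * star x' + ((∑ b, ‖v b‖ ^ 2 : ℝ) : ℂ) * (y * star y') := by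
  have h : ∀ b, (x * ket b₀ b + y * v b) * star (x' * ket b₀ b + y' * v b)
      = (if b = b₀ then x * star x' else 0) + ((‖v b‖ ^ 2 : ℝ) : ℂ) * (y * star y') := by
    intro b
    push_cast
    rw [← Complex.mul_conj']
    by_cases hb : b = b₀
    · subst hb; simp [ket, hv]
    · simp [ket, hb]; ring
  simp_rw [h]
  rw [sum_add_distrib, ← sum_mul]
  simp

/-- The bipartite vector `|u⟩|b₀⟩ + |a₀⟩|v⟩ + c |a₀⟩|b₀⟩`. -/
def wForm {α β : Type*} [DecidableEq α] [DecidableEq β] (a₀ : α) (b₀ : β) (u : α → ℂ) (v : β → ℂ)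
    (c : ℂ) : α × β → ℂ := fun p =>
  u p.1 * ket b₀ p.2 + ket a₀ p.1 * v p.2 + c * (ket a₀ p.1 * ket b₀ p.2)

theorem wForm_zero_add {α β : Type*} [DecidableEq α] [DecidableEq β] {a₀ : α} {b₀ : β}
    {u : α → ℂ} {v : β → ℂ} (c : ℂ) :
    wForm a₀ b₀ u v c = wForm a₀ b₀ u v 0 + c • ket (a₀, b₀) := by
  ext ⟨a, b⟩
  by_cases ha : a = a₀ <;> by_cases hb : b = b₀ <;> simp [wForm, ket, ha, hb]

theorem smul_wForm_zero {α β : Type*} [DecidableEq α] [DecidableEq β] {a₀ : α} {b₀ : β}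
    {u : α → ℂ} {v : β → ℂ} (k : ℂ) :
    k • wForm a₀ b₀ u v 0 = wForm a₀ b₀ (k • u) (k • v) 0 := by
  ext ⟨a, b⟩
  simp only [wForm, Pi.smul_apply, smul_eq_mul]
  ring

theorem margA_wForm {α β : Type*} [DecidableEq α] [Fintype β] [DecidableEq β] {a₀ : α} {b₀ : β}
    {u : α → ℂ} {v : β → ℂ} (hv : v b₀ = 0) (c : ℂ) :
    margA (wForm a₀ b₀ u v c)
      = proj (u + c • ket a₀) + ((∑ b, ‖v b‖ ^ 2 : ℝ) : ℂ) • proj (ket a₀) := by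
  ext a a'
  have := sum_superposition_mul_star hv ((u + c • ket a₀) a) (ket a₀ a)
    ((u + c • ket a₀) a') (ket a₀ a')
  simp only [Matrix.add_apply, Matrix.smul_apply, proj, Matrix.vecMulVec_apply, Pi.star_apply,
    smul_eq_mul]
  rw [← this, margA, Matrix.mul_apply]
  refine sum_congr rfl fun b _ => ?_
  simp only [coeffMatrix, Matrix.conjTranspose_apply, Matrix.of_apply, wForm, Pi.add_apply,
    Pi.smul_apply, smul_eq_mul]
  rw [show ∀ a, u a * ket b₀ b + ket a₀ a * v b + c * (ket a₀ a * ket b₀ b)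
    = (u a + c * ket a₀ a) * ket b₀ b + ket a₀ a * v b from fun a => by ring]
  rw [show ∀ a, u a * ket b₀ b + ket a₀ a * v b + c * (ket a₀ a * ket b₀ b)
    = (u a + c * ket a₀ a) * ket b₀ b + ket a₀ a * v b from fun a => by ring]

theorem rank_vecMulVec_add_vecMulVec_le {m n : Type*} [Fintype n] (x z : m → ℂ) (y w : n → ℂ) :
    (Matrix.vecMulVec x y + Matrix.vecMulVec z w).rank ≤ 2 := by
  have h : Matrix.vecMulVec x y + Matrix.vecMulVec z w
      = Matrix.of (fun i => ![x i, z i]) * Matrix.of ![y, w] := by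
    ext i j
    simp [Matrix.mul_apply, Matrix.vecMulVec_apply]
  rw [h]
  exact (Matrix.rank_mul_le_left _ _).trans
    ((Matrix.rank_le_card_width _).trans_eq (Fintype.card_fin 2))

/-! ### The convex roof on W-shaped states of rank at most two. -/

section

open scoped ComplexOrder

variable {α β : Type*} [Fintype α] [DecidableEq α] [Fintype β] [DecidableEq β]
  {a₀ : α} {b₀ : β} {u : α → ℂ} {v : β → ℂ}

theorem star_dotProduct_add_smul_ket (hu : u a₀ = 0) (c : ℂ) :
    dotProduct (star (u + c • ket a₀)) (u + c • ket a₀)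
      = ((∑ x, ‖u x‖ ^ 2 + ‖c‖ ^ 2 : ℝ) : ℂ) := by
  have := star_dotProduct_self u
  have h1 : dotProduct (star u) (ket a₀) = 0 := by simp [ket, hu]
  have h2 : dotProduct (star (ket a₀)) u = 0 := by simp [ket, Pi.star_single, hu]
  have h3 : dotProduct (star (ket a₀)) (ket a₀) = 1 := by simp [ket, Pi.star_single]
  simp only [star_add, star_smul, add_dotProduct, dotProduct_add, smul_dotProduct, dotProduct_smul,
    h1, h2, h3, this]
  push_cast
  rw [← Complex.mul_conj']
  simp

theorem star_ket_dotProduct_add_smul_ket (hu : u a₀ = 0) (c : ℂ) :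
    dotProduct (star (ket a₀)) (u + c • ket a₀) = c := by
  simp [ket, Pi.star_single, hu]

theorem trace_mul_self_eq_sum_eigenvalues_sq {A : Matrix α α ℂ} (hA : A.IsHermitian) :
    (A * A).trace = ((∑ i, hA.eigenvalues i ^ 2 : ℝ) : ℂ) := by
  conv_lhs => rw [hA.spectral_theorem, ← map_mul, Unitary.conjStarAlgAut_apply,
    Matrix.trace_mul_cycle, Unitary.coe_star_mul_self, one_mul, Matrix.diagonal_mul_diagonal,
    Matrix.trace_diagonal]
  simp [sq]

theorem exists_eigenvalues_pair {A : Matrix α α ℂ} (hA : A.PosSemidef) (hr : A.rank ≤ 2) :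
    ∃ x y : ℝ, 0 ≤ x ∧ 0 ≤ y ∧
      ∀ f : ℝ → ℝ, f 0 = 0 → ∑ i, f (hA.1.eigenvalues i) = f x + f y := by
  rw [hA.1.rank_eq_card_non_zero_eigs, Fintype.card_subtype] at hr
  set S := univ.filter fun i => hA.1.eigenvalues i ≠ 0 with hS
  have hsum : ∀ f : ℝ → ℝ, f 0 = 0 →
      ∑ i, f (hA.1.eigenvalues i) = ∑ i ∈ S, f (hA.1.eigenvalues i) := by
    intro f hf
    refine (sum_subset (subset_univ S) fun i _ hi => ?_).symm
    have : hA.1.eigenvalues i = 0 := by simpa [hS] using hi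
    rw [this, hf]
  interval_cases h : S.card
  · refine ⟨0, 0, le_rfl, le_rfl, fun f hf => ?_⟩
    rw [hsum f hf, card_eq_zero.1 h, hf]
    simp
  · obtain ⟨i, hi⟩ := card_eq_one.1 h
    refine ⟨hA.1.eigenvalues i, 0, hA.eigenvalues_nonneg i, le_rfl, fun f hf => ?_⟩
    rw [hsum f hf, hi, hf]
    simp
  · obtain ⟨i, j, hij, hi⟩ := card_eq_two.1 h
    refine ⟨hA.1.eigenvalues i, hA.1.eigenvalues j, hA.eigenvalues_nonneg i,
      hA.eigenvalues_nonneg j, fun f hf => ?_⟩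
    rw [hsum f hf, hi, sum_pair hij]

/-- At most two eigenvalues are nonzero, so trace and purity determine the spectrum: the gap
satisfies `(x - y) ^ 2 = 1 - C ^ 2`. -/
theorem tsallisEntropy_eq_concT {q C : ℝ} (hq : 0 < q) {A : Matrix α α ℂ} (hA : A.PosSemidef)
    (hr : A.rank ≤ 2) (h1 : A.trace = 1) (h2 : (A * A).trace = ((1 - C ^ 2 / 2 : ℝ) : ℂ)) :
    tsallisEntropy q A hA.1 = concT q C := by
  obtain ⟨x, y, hx, hy, hf⟩ := exists_eigenvalues_pair hA hr
  rw [hA.1.trace_eq_sum_eigenvalues] at h1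
  rw [trace_mul_self_eq_sum_eigenvalues_sq hA.1, Complex.ofReal_inj, hf (fun z => z ^ 2) (by simp)]
    at h2
  have h1' : x + y = 1 := by
    rw [← hf (fun z => z) rfl, ← Complex.ofReal_inj, Complex.ofReal_sum, Complex.ofReal_one]
    exact h1
  have hbin : tsallisEntropy q A hA.1 = binTsallis q x := by
    unfold tsallisEntropy binTsallis
    rw [show 1 - x = y by linarith, hf _ Real.negMulLog_zero,
      hf (fun z => z ^ q) (Real.zero_rpow hq.ne')]
  have hsymm : binTsallis q x = binTsallis q y := by
    unfold binTsallis
    rw [show 1 - x = y by linarith, show 1 - y = x by linarith, add_comm, add_comm (x ^ q)]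
  have hs : 1 - C ^ 2 = (x - y) ^ 2 := by nlinarith
  rw [hbin, concT, hs, Real.sqrt_sq_eq_abs]
  rcases le_total y x with h | h
  · rw [abs_of_nonneg (by linarith)]
    congr 1; linarith
  · rw [abs_of_nonpos (by linarith), hsymm]
    congr 1; linarith

theorem pureT_wForm {q : ℝ} (hq : 0 < q) (hu : u a₀ = 0) (hv : v b₀ = 0) {c : ℂ}
    (hn : ∑ a, ‖u a‖ ^ 2 + ∑ b, ‖v b‖ ^ 2 + ‖c‖ ^ 2 = 1) :
    pureT q (wForm a₀ b₀ u v c)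
      = concT q (2 * Real.sqrt (∑ a, ‖u a‖ ^ 2) * Real.sqrt (∑ b, ‖v b‖ ^ 2)) := by
  have hm := margA_wForm (u := u) (a₀ := a₀) hv c
  have hU : 0 ≤ ∑ a, ‖u a‖ ^ 2 := by positivity
  have hV : 0 ≤ ∑ b, ‖v b‖ ^ 2 := by positivity
  have hss := star_dotProduct_add_smul_ket hu c
  have hes := star_ket_dotProduct_add_smul_ket hu c
  have hse := star_star_dotProduct (ket a₀) (u + c • ket a₀)
  have hee : dotProduct (star (ket a₀)) (ket a₀) = 1 := by simp [ket, Pi.star_single]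
  refine tsallisEntropy_eq_concT hq (Matrix.posSemidef_self_mul_conjTranspose _) ?_ ?_ ?_
  · change (margA _).rank ≤ 2
    rw [hm]
    rw [proj, proj, ← Matrix.smul_vecMulVec]
    exact rank_vecMulVec_add_vecMulVec_le _ _ _ _
  · change (margA _).trace = 1
    rw [hm, Matrix.trace_add, Matrix.trace_smul, trace_proj, trace_proj, hss, hee]
    simp only [smul_eq_mul, mul_one]
    rw [← Complex.ofReal_add, ← Complex.ofReal_one, Complex.ofReal_inj]
    linarith
  · change Matrix.trace (margA (wForm a₀ b₀ u v c) * margA (wForm a₀ b₀ u v c)) = _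
    rw [hm, add_mul, mul_add, mul_add]
    simp only [Matrix.trace_add, Matrix.smul_mul, Matrix.mul_smul, Matrix.trace_smul,
      trace_proj_mul_proj, hss, hee, hes, ← hse, smul_eq_mul]
    rw [mul_comm (star c) c, Complex.star_def, Complex.mul_conj']
    norm_cast
    rw [mul_pow, mul_pow, Real.sq_sqrt hU, Real.sq_sqrt hV]
    rw [show ‖c‖ ^ 2 = 1 - ∑ a, ‖u a‖ ^ 2 - ∑ b, ‖v b‖ ^ 2 by linarith]
    ring

theorem sum_norm_wForm_sq (hu : u a₀ = 0) (hv : v b₀ = 0) (c : ℂ) :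
    ∑ p, ‖wForm a₀ b₀ u v c p‖ ^ 2 = ∑ a, ‖u a‖ ^ 2 + ∑ b, ‖v b‖ ^ 2 + ‖c‖ ^ 2 := by
  have h := congrArg Matrix.trace (margA_wForm (u := u) (a₀ := a₀) hv c)
  rw [Matrix.trace_add, Matrix.trace_smul, trace_proj, trace_proj,
    star_dotProduct_add_smul_ket hu c] at h
  have hee : dotProduct (star (ket a₀)) (ket a₀) = 1 := by simp [ket, Pi.star_single]
  have h2 : (margA (wForm a₀ b₀ u v c)).trace = ((∑ p, ‖wForm a₀ b₀ u v c p‖ ^ 2 : ℝ) : ℂ) := by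
    rw [Fintype.sum_prod_type]
    simp [Matrix.trace, margA, Matrix.mul_apply, coeffMatrix, Complex.mul_conj']
  rw [h2, hee, smul_eq_mul, mul_one] at h
  norm_cast at h
  rw [h]; ring

/-- The optimal decomposition: averaging over the signs of `± i√s` cancels the linear terms and
leaves `s|00⟩⟨00|`. Both vectors have the same `u` and `v`, hence equal concurrence; `c` being real
makes both of them unit vectors. -/
theorem isPureDecomposition_pair {c s : ℝ} (hu : u a₀ = 0) (hv : v b₀ = 0) (hs : 0 ≤ s)
    (hn : ∑ a, ‖u a‖ ^ 2 + ∑ b, ‖v b‖ ^ 2 + c ^ 2 + s = 1) :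
    IsPureDecomposition (proj (wForm a₀ b₀ u v c) + (s : ℂ) • proj (ket (a₀, b₀)))
      ![1 / 2, 1 / 2] ![wForm a₀ b₀ u v (c + Real.sqrt s * Complex.I),
        wForm a₀ b₀ u v (c - Real.sqrt s * Complex.I)] := by
  have hs2 : (Real.sqrt s : ℂ) * Real.sqrt s = s := by
    rw [← Complex.ofReal_mul, Real.mul_self_sqrt hs]
  refine ⟨?_, by norm_num [Fin.sum_univ_two], ?_, ?_⟩
  · intro i; fin_cases i <;> norm_num
  · intro i
    fin_cases i
    · simp only [Fin.zero_eta, Matrix.cons_val_zero]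
      rw [sum_norm_wForm_sq hu hv, ← Complex.normSq_eq_norm_sq, Complex.normSq_add_mul_I,
        Real.sq_sqrt hs]
      linarith
    · simp only [Fin.mk_one, Matrix.cons_val_one, Matrix.cons_val_zero]
      rw [sum_norm_wForm_sq hu hv, ← Complex.normSq_eq_norm_sq, sub_eq_add_neg, ← neg_mul,
        ← Complex.ofReal_neg, Complex.normSq_add_mul_I, neg_sq, Real.sq_sqrt hs]
      linarith
  · ext p p'
    have hk : star (ket (a₀, b₀) p') = ket (a₀, b₀) p' := by
      by_cases hp : p' = (a₀, b₀) <;> simp [ket, hp]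
    simp only [Fin.sum_univ_two, Matrix.cons_val_zero, Matrix.cons_val_one, wForm_zero_add (c : ℂ),
      wForm_zero_add (c + Real.sqrt s * Complex.I), wForm_zero_add (c - Real.sqrt s * Complex.I),
      Matrix.add_apply, Matrix.smul_apply, proj, Matrix.vecMulVec_apply, Pi.star_apply,
      Pi.add_apply, Pi.smul_apply, smul_eq_mul, star_add, star_mul', star_sub, hk, Complex.star_def,
      Complex.conj_ofReal, Complex.conj_I]
    push_cast
    linear_combination (-(ket (a₀, b₀) p * ket (a₀, b₀) p')) * hs2
      + (ket (a₀, b₀) p * ket (a₀, b₀) p' * (Real.sqrt s : ℂ) * Real.sqrt s) * Complex.I_sq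

theorem sum_weight_mul_norm_dotProduct_sq {ι : Type*} [Fintype ι] [DecidableEq ι] {N : ℕ}
    {w : Fin N → ℝ} {φ : Fin N → ι → ℂ} {η e : ι → ℂ} {s : ℝ}
    (h : IsPureDecomposition (proj η + (s : ℂ) • proj e) w φ) (x : ι → ℂ) :
    ∑ i, w i * ‖dotProduct (star x) (φ i)‖ ^ 2
      = ‖dotProduct (star x) η‖ ^ 2 + s * ‖dotProduct (star x) e‖ ^ 2 := by
  have h2 := congrArg (fun M => dotProduct (star x) (Matrix.mulVec M x)) h.2.2.2
  simp only [Matrix.add_mulVec, Matrix.smul_mulVec, Matrix.sum_mulVec, dotProduct_add,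
    dotProduct_smul, dotProduct_sum, star_dotProduct_proj_mulVec, smul_eq_mul] at h2
  exact_mod_cast h2.symm

/-- Jensen's inequality, because the average concurrence is independent of the decomposition. -/
theorem concT_le_sum_pureT {q : ℝ} (hq0 : 0 < q) (hq : (q - 1) ^ 2 - 3 * (q - 1) - 1 ≤ 0)
    {c s : ℝ} (hu : u a₀ = 0) (hv : v b₀ = 0) {N : ℕ} {w : Fin N → ℝ} {φ : Fin N → α × β → ℂ}
    (h : IsPureDecomposition (proj (wForm a₀ b₀ u v c) + (s : ℂ) • proj (ket (a₀, b₀))) w φ) :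
    concT q (2 * Real.sqrt (∑ a, ‖u a‖ ^ 2) * Real.sqrt (∑ b, ‖v b‖ ^ 2))
      ≤ ∑ i, w i * pureT q (φ i) := by
  have hU : 0 ≤ ∑ a, ‖u a‖ ^ 2 := by positivity
  have hV : 0 ≤ ∑ b, ‖v b‖ ^ 2 := by positivity
  set U := ∑ a, ‖u a‖ ^ 2 with hUd
  set V := ∑ b, ‖v b‖ ^ 2 with hVd
  set η := wForm a₀ b₀ u v 0 with hη
  set e : α × β → ℂ := ket (a₀, b₀) with he
  have hηη : dotProduct (star η) η = ((U + V : ℝ) : ℂ) := by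
    rw [star_dotProduct_self, sum_norm_wForm_sq hu hv]
    simp [hUd, hVd]
  have hη0 : η (a₀, b₀) = 0 := by simp [hη, wForm, hu, hv]
  have hηe : dotProduct (star η) e = 0 := by simp [he, ket, hη0]
  have hηc : dotProduct (star η) (wForm a₀ b₀ u v c) = ((U + V : ℝ) : ℂ) := by
    rw [wForm_zero_add, dotProduct_add, dotProduct_smul, hηη, hηe, smul_zero, add_zero]
  set al : Fin N → ℂ := fun i => dotProduct (star η) (φ i) / ((U + V : ℝ) : ℂ) with hal
  have hform : ∀ i, w i ≠ 0 →
      φ i = wForm a₀ b₀ (al i • u) (al i • v) (φ i (a₀, b₀)) := by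
    intro i hi
    -- The component of `φ i` orthogonal to `η` and `e`. The state has zero expectation at `χ`, so a
    -- vector of positive weight is orthogonal to `χ`, which forces `χ = 0`.
    set χ := φ i - al i • η - φ i (a₀, b₀) • e with hχ
    have hχ0 : χ (a₀, b₀) = 0 := by simp [hχ, hη0, he, ket]
    have hχe : dotProduct (star χ) e = 0 := by simp [he, ket, hχ0]
    have hηχ : dotProduct (star η) χ = 0 := by
      simp only [hχ, dotProduct_sub, dotProduct_smul, hηe, hηη, hal, smul_eq_mul]
      by_cases hz : ((U + V : ℝ) : ℂ) = 0
      · have : η = 0 := by rwa [hz, dotProduct_star_self_eq_zero] at hηη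
        simp [this]
      · rw [div_mul_cancel₀ _ hz, sub_self, mul_zero, sub_zero]
    have hχη : dotProduct (star χ) η = 0 := by
      rw [← star_star_dotProduct, hηχ, star_zero]
    have hs := sum_weight_mul_norm_dotProduct_sq h χ
    rw [wForm_zero_add, dotProduct_add, dotProduct_smul, hχη, hχe] at hs
    simp only [smul_zero, add_zero, norm_zero, ne_eq, OfNat.ofNat_ne_zero, not_false_eq_true,
      zero_pow, mul_zero] at hs
    have hi2 := (sum_eq_zero_iff_of_nonneg
      (fun j _ => mul_nonneg (h.1 j) (sq_nonneg _))).1 hs i (mem_univ i)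
    have hχφ : dotProduct (star χ) (φ i) = 0 := by
      simpa [hi] using hi2
    have hχχ : dotProduct (star χ) χ = 0 := by
      refine (congrArg (dotProduct (star χ)) hχ).trans ?_
      rw [dotProduct_sub, dotProduct_sub, dotProduct_smul, dotProduct_smul, hχφ, hχη, hχe,
        smul_zero, smul_zero, sub_zero, sub_zero]
    rw [dotProduct_star_self_eq_zero] at hχχ
    rw [wForm_zero_add, ← smul_wForm_zero, ← hη, ← he]
    rw [hχχ] at hχ
    linear_combination (exp := 1) -hχ
  have hnorm : ∀ i, w i ≠ 0 → ‖al i‖ ^ 2 * U + ‖al i‖ ^ 2 * V + ‖φ i (a₀, b₀)‖ ^ 2 = 1 := by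
    intro i hi
    have h1 := h.2.2.1 i
    rw [hform i hi, sum_norm_wForm_sq (by simp [hu]) (by simp [hv])] at h1
    simpa [mul_pow, ← mul_sum] using h1
  -- Vectors of weight zero are unconstrained; the value 0 keeps them inside the interval of
  -- convexity.
  set C : Fin N → ℝ := fun i =>
    if w i = 0 then 0 else ‖al i‖ ^ 2 * (2 * Real.sqrt U * Real.sqrt V) with hC
  have hpure : ∀ i, w i * pureT q (φ i) = w i * concT q (C i) := by
    intro i
    by_cases hi : w i = 0
    · simp [hi]
    congr 1
    rw [hform i hi, pureT_wForm hq0 (by simp [hu]) (by simp [hv])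
      (by simpa [mul_pow, ← mul_sum] using hnorm i hi)]
    congr 1
    simp only [hC, hi, if_false, Pi.smul_apply, smul_eq_mul, norm_mul, mul_pow, ← mul_sum]
    rw [Real.sqrt_mul (by positivity), Real.sqrt_mul (by positivity),
      Real.sqrt_sq (norm_nonneg _)]
    ring
  have hCmem : ∀ i, C i ∈ Set.Icc (0 : ℝ) 1 := by
    intro i
    by_cases hi : w i = 0
    · simp [hC, hi]
    simp only [hC, hi, if_false]
    refine ⟨by positivity, ?_⟩
    have h2 : 2 * Real.sqrt U * Real.sqrt V ≤ U + V := by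
      nlinarith [sq_nonneg (Real.sqrt U - Real.sqrt V), Real.sq_sqrt hU, Real.sq_sqrt hV]
    have h3 := mul_le_mul_of_nonneg_left h2 (sq_nonneg ‖al i‖)
    nlinarith [hnorm i hi, sq_nonneg ‖φ i (a₀, b₀)‖]
  have hsumC : ∑ i, w i * C i = 2 * Real.sqrt U * Real.sqrt V := by
    have h1 : ∀ i, w i * C i = w i * ‖al i‖ ^ 2 * (2 * Real.sqrt U * Real.sqrt V) := by
      intro i
      by_cases hi : w i = 0
      · simp [hi]
      · simp only [hC, hi, if_false]; ring
    simp_rw [h1]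
    rw [← sum_mul]
    by_cases hz : U + V = 0
    · have : U = 0 := by linarith
      simp [this]
    -- The expectation at `η` is `(U + V) ^ 2`, so the weighted squares of the `η` coefficients sum
    -- to 1.
    have hs := sum_weight_mul_norm_dotProduct_sq h η
    rw [hηc, hηe, Complex.norm_real, Real.norm_eq_abs, sq_abs] at hs
    have : ∑ i, w i * ‖al i‖ ^ 2 = 1 := by
      simp only [hal, norm_div, div_pow, Complex.norm_real, Real.norm_eq_abs, sq_abs, ← mul_div_assoc]
      rw [← sum_div, hs]
      field_simp
      simp
    rw [this, one_mul]
  rw [← hsumC]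
  simp_rw [hpure]
  simpa using (concT_convexOn hq0 hq).map_sum_le (t := univ) (w := w) (p := C)
    (fun i _ => h.1 i) h.2.1 (fun i _ => hCmem i)

theorem mixedT_eq_concT {q : ℝ} (hq0 : 0 < q) (hq : (q - 1) ^ 2 - 3 * (q - 1) - 1 ≤ 0)
    {c s : ℝ} (hu : u a₀ = 0) (hv : v b₀ = 0) (hs : 0 ≤ s)
    (hn : ∑ a, ‖u a‖ ^ 2 + ∑ b, ‖v b‖ ^ 2 + c ^ 2 + s = 1) :
    mixedT q (proj (wForm a₀ b₀ u v c) + (s : ℂ) • proj (ket (a₀, b₀)))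
      = concT q (2 * Real.sqrt (∑ a, ‖u a‖ ^ 2) * Real.sqrt (∑ b, ‖v b‖ ^ 2)) := by
  refine IsLeast.csInf_eq ⟨?_, ?_⟩
  · have h := isPureDecomposition_pair hu hv hs hn
    refine ⟨2, _, _, h, ?_⟩
    have h0 := h.2.2.1 0
    have h1 := h.2.2.1 1
    simp only [Matrix.cons_val_zero, Matrix.cons_val_one, sum_norm_wForm_sq hu hv] at h0 h1
    simp only [Fin.sum_univ_two, Matrix.cons_val_zero, Matrix.cons_val_one]
    rw [pureT_wForm hq0 hu hv h0, pureT_wForm hq0 hu hv h1]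
    ring
  · rintro x ⟨N, w, φ, h, rfl⟩
    exact concT_le_sum_pureT hq0 hq hu hv h

end


/-! ### Reduced density matrices of GWV states. -/

theorem sum_norm_sum_smul_ket_sq {ι κ : Type*} [Fintype ι] [DecidableEq ι] [DecidableEq κ]
    (S : Finset κ) (f : κ → ℂ) {e : κ → ι} (he : Set.InjOn e S) :
    ∑ x, ‖(∑ k ∈ S, f k • ket (e k)) x‖ ^ 2 = ∑ k ∈ S, ‖f k‖ ^ 2 := by
  rw [← Complex.ofReal_inj, ← star_dotProduct_self]
  simp only [star_sum, star_smul, sum_dotProduct, dotProduct_sum, smul_dotProduct,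
    dotProduct_smul, smul_eq_mul]
  push_cast
  refine sum_congr rfl fun k hk => ?_
  rw [sum_eq_single_of_mem k hk]
  · simp [ket, Pi.star_single, Complex.mul_conj']
  · intro l hl hlk
    have : e k ≠ e l := fun h => hlk (he hl hk h.symm)
    simp [ket, Pi.star_single, this]

variable {n d : ℕ} [NeZero d]

/-- The unnormalized `W`-class vector on an arbitrary finite set `ι` of qudits. -/
noncomputable def siteVec {ι : Type*} [Fintype ι] [DecidableEq ι] (b : ι → Fin d → ℂ) :
    (ι → Fin d) → ℂ :=
  ∑ s : ι, ∑ i ∈ univ.filter (fun i : Fin d => i ≠ 0),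
    b s i • ket (Function.update (fun _ : ι => (0 : Fin d)) s i)

theorem siteVec_zero {ι : Type*} [Fintype ι] [DecidableEq ι] (b : ι → Fin d → ℂ) :
    siteVec b (fun _ => 0) = 0 := by
  simp only [siteVec, Finset.sum_apply, Pi.smul_apply, smul_eq_mul]
  refine sum_eq_zero fun s _ => sum_eq_zero fun i hi => ?_
  have : (fun _ : ι => (0 : Fin d)) ≠ Function.update (fun _ => 0) s i := fun h =>
    (mem_filter.1 hi).2 (by simpa using (congrFun h s).symm)
  simp [ket, this]

theorem sum_norm_siteVec_sq {ι : Type*} [Fintype ι] [DecidableEq ι] (b : ι → Fin d → ℂ) :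
    ∑ x, ‖siteVec b x‖ ^ 2
      = ∑ s : ι, ∑ i ∈ univ.filter (fun i : Fin d => i ≠ 0), ‖b s i‖ ^ 2 := by
  unfold siteVec
  rw [← sum_product' univ _ fun s i => ‖b s i‖ ^ 2]
  rw [← sum_product' univ _ fun s i => b s i • ket (Function.update (fun _ : ι => (0 : Fin d)) s i)]
  refine sum_norm_sum_smul_ket_sq _ (fun p : ι × Fin d => b p.1 p.2)
    (e := fun p => Function.update (fun _ : ι => (0 : Fin d)) p.1 p.2) ?_
  rintro ⟨s, i⟩ hi ⟨s', i'⟩ hi' h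
  have hi0 : i ≠ 0 := by simpa using hi
  have h1 := congrFun h s
  simp only [Function.update_self] at h1
  by_cases hs : s = s'
  · subst hs
    simpa using h1
  · rw [Function.update_of_ne hs] at h1
    exact absurd h1 hi0

theorem glue_injective {n d : ℕ} {P R : Finset (Fin n)} (hPR : Disjoint P R) {x x' : P → Fin d}
    {y y' : R → Fin d} {z z' : {i : Fin n // i ∉ P ∪ R} → Fin d} :
    glue P R x y z = glue P R x' y' z' ↔ x = x' ∧ y = y' ∧ z = z' := by
  refine ⟨fun h => ⟨?_, ?_, ?_⟩, by rintro ⟨rfl, rfl, rfl⟩; rfl⟩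
  · ext1 ⟨i, hi⟩
    simpa [glue, hi] using congrFun h i
  · ext1 ⟨i, hi⟩
    have hP : i ∉ P := fun hP => disjoint_left.1 hPR hP hi
    simpa [glue, hi, hP] using congrFun h i
  · ext1 ⟨i, hi⟩
    have hP : i ∉ P := fun h => hi (mem_union_left _ h)
    have hR : i ∉ R := fun h => hi (mem_union_right _ h)
    simpa [glue, hP, hR] using congrFun h i

theorem ket_glue {n d : ℕ} {P R : Finset (Fin n)} (hPR : Disjoint P R) (x x' : P → Fin d)
    (y y' : R → Fin d) (z z' : {i : Fin n // i ∉ P ∪ R} → Fin d) :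
    ket (glue P R x y z) (glue P R x' y' z') = ket x x' * ket y y' * ket z z' := by
  simp only [ket, Pi.single_apply, glue_injective hPR]
  by_cases h1 : x' = x <;> by_cases h2 : y' = y <;> by_cases h3 : z' = z <;> simp [h1, h2, h3]

theorem sum_eq_sum_parts {M : Type*} [AddCommMonoid M] {P R : Finset (Fin n)}
    (hPR : Disjoint P R) (f : Fin n → M) :
    ∑ s, f s = ∑ s : P, f s + ∑ s : R, f s + ∑ s : {i : Fin n // i ∉ P ∪ R}, f s := by
  rw [sum_coe_sort P f, sum_coe_sort R f, ← sum_union hPR, ← sum_add_sum_compl (P ∪ R)]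
  congr 1
  exact sum_subtype _ (fun i => mem_compl) f

theorem glue_zero {P R : Finset (Fin n)} :
    glue P R (fun _ => 0) (fun _ => 0) (fun _ => 0) = fun _ => (0 : Fin d) := by
  ext1 i
  simp [glue]

theorem siteVec_glue {P R : Finset (Fin n)} (hPR : Disjoint P R) (b : Fin n → Fin d → ℂ)
    (x : P → Fin d) (y : R → Fin d) (z : {i : Fin n // i ∉ P ∪ R} → Fin d) :
    siteVec b (glue P R x y z)
      = siteVec (fun s : P => b s) x * ket (fun _ => 0) y * ket (fun _ => 0) z
      + ket (fun _ => 0) x * siteVec (fun s : R => b s) y * ket (fun _ => 0) z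
      + ket (fun _ => 0) x * ket (fun _ => 0) y
        * siteVec (fun s : {i : Fin n // i ∉ P ∪ R} => b s) z := by
  simp only [siteVec, Finset.sum_apply, Pi.smul_apply, smul_eq_mul]
  rw [sum_eq_sum_parts hPR fun s => ∑ i ∈ univ.filter (fun i : Fin d => i ≠ 0),
    b s i * ket (Function.update (fun _ => 0) s i) (glue P R x y z)]
  simp only [mul_sum, sum_mul]
  refine congrArg₂ (· + ·) (congrArg₂ (· + ·) ?_ ?_) ?_
  · refine sum_congr rfl fun s _ => sum_congr rfl fun i _ => ?_
    have : Function.update (fun _ => (0 : Fin d)) (s : Fin n) i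
        = glue P R (Function.update (fun _ => 0) s i) (fun _ => 0) (fun _ => 0) := by
      ext1 j
      by_cases hj : j ∈ P
      · simp [glue, hj, Function.update_apply, Subtype.ext_iff]
      · have : j ≠ s := fun h => hj (h ▸ s.2)
        simp [glue, hj, this]
    rw [this, ket_glue hPR]
    ring
  · refine sum_congr rfl fun s _ => sum_congr rfl fun i _ => ?_
    have : Function.update (fun _ => (0 : Fin d)) (s : Fin n) i
        = glue P R (fun _ => 0) (Function.update (fun _ => 0) s i) (fun _ => 0) := by
      ext1 j
      by_cases hj : j ∈ R
      · have hP : j ∉ P := fun hP => disjoint_left.1 hPR hP hj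
        simp [glue, hj, hP, Function.update_apply, Subtype.ext_iff]
      · have : j ≠ s := fun h => hj (h ▸ s.2)
        simp [glue, hj, this]
    rw [this, ket_glue hPR]
    ring
  · refine sum_congr rfl fun s _ => sum_congr rfl fun i _ => ?_
    have : Function.update (fun _ => (0 : Fin d)) (s : Fin n) i
        = glue P R (fun _ => 0) (fun _ => 0) (Function.update (fun _ => 0) s i) := by
      ext1 j
      by_cases hj : j ∈ P ∪ R
      · have : j ≠ s := fun h => s.2 (h ▸ hj)
        by_cases hP : j ∈ P
        · simp [glue, this, hP]
        · have hR : j ∈ R := (mem_union.1 hj).resolve_left hP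
          simp [glue, this, hP, hR]
      · have hP : j ∉ P := fun h => hj (mem_union_left _ h)
        have hR : j ∉ R := fun h => hj (mem_union_right _ h)
        simp [glue, hP, hR, Function.update_apply, Subtype.ext_iff]
    rw [this, ket_glue hPR]
    ring

/-- A single excitation sits in `P`, in `R` or outside. Outside it leaves `|00⟩` on `P ∪ R` and is
orthogonal to the outer vacuum, so it contributes incoherently. -/
theorem reduced_proj_siteVec {P R : Finset (Fin n)} (hPR : Disjoint P R) (b : Fin n → Fin d → ℂ)
    (c : ℂ) :
    reduced (proj (siteVec b + c • ket (fun _ : Fin n => (0 : Fin d)))) P R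
      = proj (wForm (fun _ => 0) (fun _ => 0) (siteVec fun s : P => b s)
          (siteVec fun s : R => b s) c)
        + ((∑ z, ‖siteVec (fun s : {i : Fin n // i ∉ P ∪ R} => b s) z‖ ^ 2 : ℝ) : ℂ)
          • proj (ket (fun _ => 0, fun _ => 0)) := by
  ext ⟨x, y⟩ ⟨x', y'⟩
  have hψ : ∀ x y z, (siteVec b + c • ket (fun _ : Fin n => (0 : Fin d))) (glue P R x y z)
      = wForm (fun _ => 0) (fun _ => 0) (siteVec fun s : P => b s) (siteVec fun s : R => b s) c
          (x, y) * ket (fun _ => 0) z + ket (fun _ => 0, fun _ => 0) (x, y)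
          * siteVec (fun s : {i : Fin n // i ∉ P ∪ R} => b s) z := by
    intro x y z
    have hk : ket ((fun _ => 0, fun _ => 0) : (P → Fin d) × (R → Fin d)) (x, y)
        = ket (fun _ => 0) x * ket (fun _ => 0) y := by
      by_cases hx : x = fun _ => 0 <;> by_cases hy : y = fun _ => 0 <;> simp [ket, hx, hy]
    rw [Pi.add_apply, Pi.smul_apply, siteVec_glue hPR, ← glue_zero (P := P) (R := R), ket_glue hPR,
      hk, smul_eq_mul, wForm]
    ring
  simp only [reduced, proj, Matrix.of_apply, Matrix.vecMulVec_apply, Pi.star_apply,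
    Matrix.add_apply, Matrix.smul_apply, smul_eq_mul, hψ]
  exact sum_superposition_mul_star (siteVec_zero _) _ _ _ _

/-- One weight function `m` serves all `q`, `P` and `R`, which makes different cuts comparable. -/
theorem exists_T_eq_concT {ψ : (Fin n → Fin d) → ℂ} (hψ : IsGWV ψ) :
    ∃ m : Fin n → ℝ, (∀ s, 0 ≤ m s) ∧ ∑ s, m s ≤ 1 ∧
      ∀ q : ℝ, 0 < q → (q - 1) ^ 2 - 3 * (q - 1) - 1 ≤ 0 → ∀ P R, Disjoint P R →
        T q ψ P R = concT q (2 * Real.sqrt (∑ s ∈ P, m s) * Real.sqrt (∑ s ∈ R, m s)) := by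
  obtain ⟨a, p, hp0, hp1, ha, rfl⟩ := hψ
  set b : Fin n → Fin d → ℂ := fun s i => (Real.sqrt p : ℂ) * a s i with hb
  have hw : (Real.sqrt p : ℂ) • wVector a = siteVec b := by
    simp only [wVector, siteVec, smul_sum, hb, mul_smul]
  set m : Fin n → ℝ := fun s => ∑ i ∈ univ.filter (fun i : Fin d => i ≠ 0), ‖b s i‖ ^ 2 with hm
  have hsum : ∑ s, m s = p := by
    simp only [hm, hb, norm_mul, mul_pow, ← mul_sum, ha, Complex.norm_real, Real.norm_eq_abs,
      sq_abs, Real.sq_sqrt hp0, mul_one]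
  refine ⟨m, fun s => by positivity, hsum.trans_le hp1, fun q hq0 hq P R hPR => ?_⟩
  rw [hw, T, reduced_proj_siteVec hPR, mixedT_eq_concT hq0 hq (siteVec_zero _) (siteVec_zero _)
    (by positivity)]
  · simp only [sum_norm_siteVec_sq]
    rw [sum_coe_sort P m, sum_coe_sort R m]
  · simp only [sum_norm_siteVec_sq]
    have := sum_eq_sum_parts hPR m
    rw [Real.sq_sqrt (by linarith)]
    simp only [hm] at this hsum
    linarith

/-! ### Superadditivity of the squared entanglement. -/

theorem binTsallis_nonneg {q x : ℝ} (h0 : 0 ≤ x) (h1 : x ≤ 1) :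
    0 ≤ binTsallis q x := by
  have h1x : 0 ≤ 1 - x := by linarith
  unfold binTsallis
  split_ifs with h
  · exact add_nonneg (Real.negMulLog_nonneg h0 h1) (Real.negMulLog_nonneg h1x (by linarith))
  rcases lt_or_gt_of_ne h with h | h
  · have e1 := Real.self_le_rpow_of_le_one h0 h1 h.le
    have e2 := Real.self_le_rpow_of_le_one h1x (by linarith) h.le
    exact div_nonneg_of_nonpos (by linarith) (by linarith)
  · have e1 := Real.rpow_le_self_of_le_one h0 h1 h.le
    have e2 := Real.rpow_le_self_of_le_one h1x (by linarith) h.le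
    exact div_nonneg (by linarith) (by linarith)

theorem concT_nonneg (q C : ℝ) : 0 ≤ concT q C := by
  have h : Real.sqrt (1 - C ^ 2) ≤ 1 := Real.sqrt_le_one.2 (by nlinarith)
  exact binTsallis_nonneg (by positivity) (by linarith)

/-- Convexity and `concT q 0 = 0` give `concT q X ≤ (X / C) * concT q C` for `X ≤ C`; squaring and
adding finishes. -/
theorem concT_sq_add_sq_le {q : ℝ} (hq0 : 0 < q) (hq : (q - 1) ^ 2 - 3 * (q - 1) - 1 ≤ 0)
    {A B C : ℝ} (hA : 0 ≤ A) (hB : 0 ≤ B) (hC : 0 ≤ C) (hC1 : C ≤ 1) (h : A ^ 2 + B ^ 2 = C ^ 2) :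
    concT q A ^ 2 + concT q B ^ 2 ≤ concT q C ^ 2 := by
  rcases hC.eq_or_lt with rfl | hC0
  · have hA0 : A = 0 := by nlinarith
    have hB0 : B = 0 := by nlinarith
    simp [hA0, hB0, concT_zero hq0]
  have key : ∀ X, 0 ≤ X → X ≤ C → concT q X ^ 2 ≤ X ^ 2 / C ^ 2 * concT q C ^ 2 := by
    intro X hX hXC
    have h1 : 0 ≤ 1 - X / C := by rw [sub_nonneg]; exact div_le_one_of_le₀ hXC hC
    have := (concT_convexOn hq0 hq).2 (Set.mem_Icc.2 ⟨hC, hC1⟩)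
      (Set.mem_Icc.2 ⟨le_rfl, zero_le_one⟩) (div_nonneg hX hC) h1 (by ring)
    simp only [smul_eq_mul, mul_zero, add_zero, concT_zero hq0, div_mul_cancel₀ _ hC0.ne'] at this
    have := pow_le_pow_left₀ (concT_nonneg q X) this 2
    rwa [mul_pow, div_pow] at this
  have e1 := key A hA (by nlinarith)
  have e2 := key B hB (by nlinarith)
  have e3 : A ^ 2 / C ^ 2 * concT q C ^ 2 + B ^ 2 / C ^ 2 * concT q C ^ 2 = concT q C ^ 2 := by
    rw [← add_mul, ← add_div, h, div_self (by positivity), one_mul]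
  linarith

theorem T_nonneg {ψ : (Fin n → Fin d) → ℂ} (hψ : IsGWV ψ) {q : ℝ} (hq0 : 0 < q)
    (hq : (q - 1) ^ 2 - 3 * (q - 1) - 1 ≤ 0) {P R : Finset (Fin n)} (h : Disjoint P R) :
    0 ≤ T q ψ P R := by
  obtain ⟨m, -, -, hT⟩ := exists_T_eq_concT hψ
  rw [hT q hq0 hq P R h]
  exact concT_nonneg q _

theorem T_sq_add_sq_le {ψ : (Fin n → Fin d) → ℂ} (hψ : IsGWV ψ) {q : ℝ} (hq0 : 0 < q)
    (hq : (q - 1) ^ 2 - 3 * (q - 1) - 1 ≤ 0) {P R R' : Finset (Fin n)} (h : Disjoint P R)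
    (h' : Disjoint P R') (hR : Disjoint R R') :
    T q ψ P R ^ 2 + T q ψ P R' ^ 2 ≤ T q ψ P (R ∪ R') ^ 2 := by
  obtain ⟨m, hm0, hm1, hT⟩ := exists_T_eq_concT hψ
  have hU : Disjoint P (R ∪ R') := disjoint_union_right.2 ⟨h, h'⟩
  rw [hT q hq0 hq P R h, hT q hq0 hq P R' h', hT q hq0 hq P _ hU]
  have h0 : ∀ S : Finset (Fin n), 0 ≤ ∑ s ∈ S, m s := fun S => sum_nonneg fun s _ => hm0 s
  refine concT_sq_add_sq_le hq0 hq (by positivity) (by positivity) (by positivity) ?_ ?_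
  · have h1 : ∑ s ∈ P, m s + ∑ s ∈ R ∪ R', m s ≤ 1 := by
      rw [← sum_union hU]
      exact (sum_le_univ_sum_of_nonneg hm0).trans hm1
    nlinarith [sq_nonneg (Real.sqrt (∑ s ∈ P, m s) - Real.sqrt (∑ s ∈ R ∪ R', m s)),
      Real.sq_sqrt (h0 P), Real.sq_sqrt (h0 (R ∪ R'))]
  · simp only [mul_pow, Real.sq_sqrt (h0 _)]
    rw [sum_union hR]
    ring

/-! ### The weighted power inequality and its iteration. -/

/-- The second summand is the increment of the convex function `z ^ b` from `y / k` to `y / k + y`.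
Since `y / k ≤ x`, it is at most the increment from `x` to `x + y`. -/
theorem rpow_add_K_mul_rpow_le {x y k b : ℝ} (hb : 1 ≤ b) (hk : 0 < k) (hy : 0 ≤ y)
    (h : y ≤ k * x) :
    x ^ b + ((1 + k) ^ b - 1) / k ^ b * y ^ b ≤ (x + y) ^ b := by
  rcases hy.eq_or_lt with rfl | hy0
  · rw [Real.zero_rpow (by linarith)]
    simp
  have hl0 : 0 < y / k := by positivity
  have hlx : y / k ≤ x := by rw [div_le_iff₀ hk]; linarith
  have hK : ((1 + k) ^ b - 1) / k ^ b * y ^ b = (y / k + y) ^ b - (y / k) ^ b := by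
    have : y / k + y = (1 + k) * (y / k) := by field_simp
    rw [this, Real.mul_rpow (by positivity) hl0.le, Real.div_rpow hy hk.le]
    ring
  have hD : 0 < x + y - y / k := by linarith
  have ht : y / (x + y - y / k) ≤ 1 := (div_le_one hD).2 (by linarith)
  have hf := convexOn_rpow hb
  have hx : 0 ≤ x := hl0.le.trans hlx
  -- Both inner points `y / k + y` and `x` are convex combinations of `y / k` and `x + y`, with
  -- swapped weights; the two bounds add up.
  have e1 := hf.2 (x := y / k) hl0.le (y := x + y) (by simp only [Set.mem_Ici]; positivity)
    (sub_nonneg.2 ht) (by positivity : 0 ≤ y / (x + y - y / k)) (by ring)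
  have e2 := hf.2 (x := y / k) hl0.le (y := x + y) (by simp only [Set.mem_Ici]; positivity)
    (by positivity : 0 ≤ y / (x + y - y / k)) (sub_nonneg.2 ht) (by ring)
  simp only [smul_eq_mul] at e1 e2
  have e3 : (1 - y / (x + y - y / k)) * (y / k) + y / (x + y - y / k) * (x + y) = y / k + y := by
    rw [show (1 - y / (x + y - y / k)) * (y / k) + y / (x + y - y / k) * (x + y)
      = y / k + y / (x + y - y / k) * (x + y - y / k) by ring, div_mul_cancel₀ _ hD.ne']
  have e4 : y / (x + y - y / k) * (y / k) + (1 - y / (x + y - y / k)) * (x + y) = x := by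
    rw [show y / (x + y - y / k) * (y / k) + (1 - y / (x + y - y / k)) * (x + y)
      = x + y - y / (x + y - y / k) * (x + y - y / k) by ring, div_mul_cancel₀ _ hD.ne']
    ring
  rw [e3] at e1
  rw [e4] at e2
  rw [hK]
  linarith

theorem K_nonneg {k β : ℝ} (hβ : 0 ≤ β) (hk : 0 < k) : 0 ≤ K k β := by
  have : 1 ≤ (1 + k) ^ (β / 2) := Real.one_le_rpow (by linarith) (by linarith)
  exact div_nonneg (by linarith) (by positivity)

theorem rpow_add_K_mul_rpow_le_of_sq {x y z k β : ℝ} (hβ : 2 ≤ β) (hk : 0 < k) (hx : 0 ≤ x)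
    (hy : 0 ≤ y) (hz : 0 ≤ z) (h : y ^ 2 ≤ k * x ^ 2) (hxyz : x ^ 2 + y ^ 2 ≤ z ^ 2) :
    x ^ β + K k β * y ^ β ≤ z ^ β := by
  have e : ∀ a : ℝ, 0 ≤ a → a ^ β = (a ^ 2) ^ (β / 2) := by
    intro a ha
    rw [← Real.rpow_natCast, ← Real.rpow_mul ha]
    congr 1
    push_cast
    ring
  rw [e x hx, e y hy, e z hz]
  exact (rpow_add_K_mul_rpow_le (by linarith) hk (sq_nonneg y) h).trans
    (Real.rpow_le_rpow (by positivity) hxyz (by linarith))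

theorem monogamy_of_sq_superadditive {A B : ℕ → ℝ} {r t : ℕ} (hr : t + 2 ≤ r) {k β : ℝ}
    (hβ : 2 ≤ β) (hk : 0 < k) (hA : ∀ j < r, 0 ≤ A j) (hB : ∀ j < r, 0 ≤ B j)
    (hAB : ∀ j, j + 1 < r → A j ^ 2 + B (j + 1) ^ 2 ≤ B j ^ 2) (hlast : B (r - 1) = A (r - 1))
    (h1 : ∀ j ≤ t, B (j + 1) ^ 2 ≤ k * A j ^ 2)
    (h2 : ∀ j, t + 1 ≤ j → j ≤ r - 2 → A j ^ 2 ≤ k * B (j + 1) ^ 2) :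
    ∑ j ∈ Icc 0 t, K k β ^ j * A j ^ β + K k β ^ (t + 2) * ∑ j ∈ Icc (t + 1) (r - 2), A j ^ β
      + K k β ^ (t + 1) * A (r - 1) ^ β ≤ B 0 ^ β := by
  have hK := K_nonneg (by linarith : 0 ≤ β) hk
  -- Up to index `t` the remainder `B (m + 1)` is the smaller part and carries the factor `K`, so
  -- powers of `K` accumulate.
  have first : ∀ m ≤ t + 1,
      ∑ j ∈ range m, K k β ^ j * A j ^ β + K k β ^ m * B m ^ β ≤ B 0 ^ β := by
    intro m
    induction m with
    | zero => simp
    | succ m ih =>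
      intro hm
      have := mul_le_mul_of_nonneg_left (rpow_add_K_mul_rpow_le_of_sq hβ hk (hA m (by omega))
        (hB (m + 1) (by omega)) (hB m (by omega)) (h1 m (by omega)) (hAB m (by omega)))
        (pow_nonneg hK m)
      have ih' := ih (by omega)
      rw [sum_range_succ, pow_succ]
      linarith
  -- Beyond `t` the roles swap: each `A j` gets one factor `K` and the remainder none.
  have second : ∀ m, t + 1 ≤ m → m ≤ r - 1 →
      K k β * ∑ j ∈ Ico (t + 1) m, A j ^ β + B m ^ β ≤ B (t + 1) ^ β := by
    intro m hm
    induction m, hm using Nat.le_induction with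
    | base => simp
    | succ m hm ih =>
      intro hmr
      have := rpow_add_K_mul_rpow_le_of_sq hβ hk (hB (m + 1) (by omega)) (hA m (by omega))
        (hB m (by omega)) (h2 m hm (by omega)) (by linarith [hAB m (by omega)])
      have ih' := ih (by omega)
      rw [sum_Ico_succ_top hm]
      linarith
  have e1 := first (t + 1) le_rfl
  have e2 := mul_le_mul_of_nonneg_left (second (r - 1) (by omega) le_rfl) (pow_nonneg hK (t + 1))
  rw [hlast, show Ico (t + 1) (r - 1) = Icc (t + 1) (r - 2) by ext; simp; omega] at e2
  rw [show Icc 0 t = range (t + 1) by ext; simp, pow_succ _ (t + 1)]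
  linarith

end TsallisGWV

/-! ### The monogamy inequality for GWV states. -/

theorem theorem3 {n d : ℕ} [NeZero d] (ψ : (Fin n → Fin d) → ℂ) (hψ : TsallisGWV.IsGWV ψ)
    (r t : ℕ) (hr : 3 ≤ r) (ht : t ≤ r - 3)
    (P : Finset (Fin n)) (Q : ℕ → Finset (Fin n))
    (hP : P.Nonempty) (hQ : ∀ j < r, (Q j).Nonempty)
    (hPQ : ∀ j < r, Disjoint P (Q j))
    (hQQ : ∀ i < r, ∀ j < r, i ≠ j → Disjoint (Q i) (Q j))
    (q : ℝ) (hq : q ∈ Set.Icc ((5 - Real.sqrt 13) / 2) ((5 + Real.sqrt 13) / 2))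
    (β : ℝ) (hβ : 2 ≤ β) (k : ℝ) (hk0 : 0 < k) (hk1 : k ≤ 1)
    (h1 : ∀ i ≤ t, TsallisGWV.T q ψ P ((Finset.Ico (i + 1) r).biUnion Q) ^ 2
      ≤ k * TsallisGWV.T q ψ P (Q i) ^ 2)
    (h2 : ∀ j, t + 1 ≤ j → j ≤ r - 2 → TsallisGWV.T q ψ P (Q j) ^ 2
      ≤ k * TsallisGWV.T q ψ P ((Finset.Ico (j + 1) r).biUnion Q) ^ 2) :
    ∑ j ∈ Finset.Icc 0 t, TsallisGWV.K k β ^ j * TsallisGWV.T q ψ P (Q j) ^ β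
      + TsallisGWV.K k β ^ (t + 2)
        * ∑ j ∈ Finset.Icc (t + 1) (r - 2), TsallisGWV.T q ψ P (Q j) ^ β
      + TsallisGWV.K k β ^ (t + 1) * TsallisGWV.T q ψ P (Q (r - 1)) ^ β
    ≤ TsallisGWV.T q ψ P ((Finset.range r).biUnion Q) ^ β := by

  have h13 := Real.sq_sqrt (show (0 : ℝ) ≤ 13 by norm_num)
  have h13' : Real.sqrt 13 < 5 := by rw [Real.sqrt_lt' (by norm_num)]; norm_num
  have hq0 : 0 < q := by linarith [hq.1]
  -- The endpoints of the range of `q` are the roots of this quadratic.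
  have hq' : (q - 1) ^ 2 - 3 * (q - 1) - 1 ≤ 0 := by
    nlinarith [mul_nonneg (sub_nonneg.2 hq.1) (sub_nonneg.2 hq.2)]
  have hdisj : ∀ j, Disjoint P ((Finset.Ico j r).biUnion Q) := fun j =>
    (Finset.disjoint_biUnion_right _ _ _).2 fun i hi => hPQ i (Finset.mem_Ico.1 hi).2
  rw [Finset.range_eq_Ico]
  refine TsallisGWV.monogamy_of_sq_superadditive (A := fun j => TsallisGWV.T q ψ P (Q j))
    (B := fun j => TsallisGWV.T q ψ P ((Finset.Ico j r).biUnion Q)) (by omega) hβ hk0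
    (fun j hj => TsallisGWV.T_nonneg hψ hq0 hq' (hPQ j hj))
    (fun j _ => TsallisGWV.T_nonneg hψ hq0 hq' (hdisj j)) ?_ ?_ h1 h2
  · intro j hj
    have hIco : Finset.Ico j r = insert j (Finset.Ico (j + 1) r) :=
      (Finset.insert_Ico_add_one_left_eq_Ico (by omega)).symm
    simp only [hIco, Finset.biUnion_insert]
    refine TsallisGWV.T_sq_add_sq_le hψ hq0 hq' (hPQ j (by omega)) (hdisj _) ?_
    refine (Finset.disjoint_biUnion_right _ _ _).2 fun i hi => ?_
    rw [Finset.mem_Ico] at hi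
    exact hQQ j (by omega) i hi.2 (by omega)
  · have hIco : Finset.Ico (r - 1) r = {r - 1} := by ext; simp; omega
    simp only [hIco, Finset.singleton_biUnion]
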